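/- All algebras are finite-dimensional vector spaces over $\mathbb{R}$ with a bilinear product, not assumed to have a unit; an algebra $A$ is nilpotent if its lower central series $c^1(A)=A$, $c^{m+1}(A)=\operatorname{span}\{xy : x\in c^m(A),\ y\in A\}$ reaches $0$. Below, each algebra has basis $a,b,c,d$ and a commutative product, and every product of two basis vectors that is not determined by the listed ones and commutativity is zero. A (commutative) algebra has a central component if it is a direct sum of two ideals $I_1\oplus I_2$ with $I_2\neq 0$ and $I_2$ contained in the centre $\{x : xy=0 \text{ for all } y\}$. **Theorem.** Up to isomorphism there are exactly $12$ commutative nilpotent associative algebras of dimension $4$ over $\mathbb{R}$. That is, the following $12$ algebras are nilpotent, commutative, associative, of dimension $4$ and pairwise non-isomorphic, and every commutative nilpotent associative real algebra of dimension $4$ is isomorphic to one of them. With a central component: - $J_{4,1}$: all products are zero; - $J_{4,2}$: $a^2=b$; - $J_{4,3}^{\alpha}$ ($\alpha=\pm1$): $a^2=c,\ b^2=\alpha c$; - $J_{4,4}$: $a^2=b,\ ab=c$. Without a central component: - $J_{4,5}^{\alpha}$ ($\alpha=\pm1$): $a^2=d,\ b^2=d,\ c^2=\alpha d$; - $J_{4,7}$: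 $a^2=b,\ ab=d,\ c^2=d$; - $J_{4,11}$: $a^2=b,\ ab=c,\ ac=d,\ b^2=d$; - $J_{4,12}$: $a^2=c,\ ab=d$; - $J_{4,13}^{\alpha}$ ($\alpha=\pm1$): $a^2=c,\ b^2=\alpha c,\ ab=d$. Moreover, these $12$ algebras are exactly the associative members of the list of $17$ four-dimensional real nilpotent Jordan algebras consisting of them together with the following five: - $J_{4,6}$: $a^2=b,\ bc=d$; - $J_{4,8}^{\alpha}$ ($\alpha=\pm1$): $a^2=c,\ b^2=\alpha c,\ ac=d$; - $J_{4,9}$: $a^2=c,\ b^2=-c,\ ac=d,\ bc=d$; - $J_{4,10}$: $a^2=c,\ b^2=-c,\ ac=d,\ bc=d,\ ab=d$. -/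

import Mathlib

noncomputable section

namespace RealNilpotentJordan

/-! Algebras over `ℝ` are not assumed associative or unital; the type classes below give a
bilinear product. -/

section General

variable (A : Type*) [NonUnitalNonAssocRing A] [Module ℝ A]

/-- The lower central series of `A`, indexed from `0`:
`lowerCentral A 0 = A` and `lowerCentral A (m + 1)` is the linear span of all products `x * y`
with `x` in `lowerCentral A m` and `y` in `A`. -/
def lowerCentral : ℕ → Submodule ℝ A
  | 0 => ⊤
  | m + 1 => Submodule.span ℝ {z | ∃ x ∈ lowerCentral m, ∃ y : A, z = x * y}

/-- `A` is nilpotent: its lower central series reaches `0`. -/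
def IsNilpotentAlgebra : Prop := ∃ m : ℕ, lowerCentral A m = ⊥

/-- `A` has a central component: it is the direct sum of two ideals `I₁` and `I₂`, with `I₂`
nonzero and contained in the centre `{x | ∀ y, x * y = 0}` (for commutative `A`). -/
def HasCentralComponent : Prop :=
  ∃ I₁ I₂ : Submodule ℝ A,
    (∀ x ∈ I₁, ∀ y : A, x * y ∈ I₁ ∧ y * x ∈ I₁) ∧
    (∀ x ∈ I₂, ∀ y : A, x * y ∈ I₂ ∧ y * x ∈ I₂) ∧
    IsCompl I₁ I₂ ∧ I₂ ≠ ⊥ ∧ ∀ x ∈ I₂, ∀ y : A, x * y = 0 ∧ y * x = 0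

/-- `A` and `B` are isomorphic as real algebras. -/
def IsIsomorphic (A B : Type*) [NonUnitalNonAssocRing A] [Module ℝ A]
    [NonUnitalNonAssocRing B] [Module ℝ B] : Prop :=
  ∃ f : A ≃ₗ[ℝ] B, ∀ x y : A, f (x * y) = f x * f y

end General

/-- Names of the seventeen algebras in the list of real `4`-dimensional nilpotent Jordan
algebras; the parameter `α` is a sign `±1`. -/
inductive Label where
  | J1
  | J2
  | J3 (α : ℤˣ)
  | J4
  | J5 (α : ℤˣ)
  | J6
  | J7
  | J8 (α : ℤˣ)
  | J9
  | J10
  | J11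
  | J12
  | J13 (α : ℤˣ)
  deriving DecidableEq

/-- A sign as a real number. -/
def sgn (α : ℤˣ) : ℝ := ((α : ℤ) : ℝ)

/-- The basis vector `b` of `ℝ⁴` with standard basis `a, b, c, d`. -/
def eb : Fin 4 → ℝ := ![0, 1, 0, 0]

/-- The basis vector `c`. -/
def ec : Fin 4 → ℝ := ![0, 0, 1, 0]

/-- The basis vector `d`. -/
def ed : Fin 4 → ℝ := ![0, 0, 0, 1]

/-- Multiplication tables: rows and columns are indexed by the basis `a, b, c, d`, and the
entries are the products of basis vectors. -/
def table : Label → Matrix (Fin 4) (Fin 4) (Fin 4 → ℝ)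
  -- all products are zero
  | .J1 => 0
  -- a² = b
  | .J2 => !![eb, 0, 0, 0; 0, 0, 0, 0; 0, 0, 0, 0; 0, 0, 0, 0]
  -- a² = c, b² = α c
  | .J3 α => !![ec, 0, 0, 0; 0, sgn α • ec, 0, 0; 0, 0, 0, 0; 0, 0, 0, 0]
  -- a² = b, ab = c
  | .J4 => !![eb, ec, 0, 0; ec, 0, 0, 0; 0, 0, 0, 0; 0, 0, 0, 0]
  -- a² = d, b² = d, c² = α d
  | .J5 α => !![ed, 0, 0, 0; 0, ed, 0, 0; 0, 0, sgn α • ed, 0; 0, 0, 0, 0]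
  -- a² = b, bc = d
  | .J6 => !![eb, 0, 0, 0; 0, 0, ed, 0; 0, ed, 0, 0; 0, 0, 0, 0]
  -- a² = b, ab = d, c² = d
  | .J7 => !![eb, ed, 0, 0; ed, 0, 0, 0; 0, 0, ed, 0; 0, 0, 0, 0]
  -- a² = c, b² = α c, ac = d
  | .J8 α => !![ec, 0, ed, 0; 0, sgn α • ec, 0, 0; ed, 0, 0, 0; 0, 0, 0, 0]
  -- a² = c, b² = -c, ac = d, bc = d
  | .J9 => !![ec, 0, ed, 0; 0, -ec, ed, 0; ed, ed, 0, 0; 0, 0, 0, 0]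
  -- a² = c, b² = -c, ac = d, bc = d, ab = d
  | .J10 => !![ec, ed, ed, 0; ed, -ec, ed, 0; ed, ed, 0, 0; 0, 0, 0, 0]
  -- a² = b, ab = c, ac = d, b² = d
  | .J11 => !![eb, ec, ed, 0; ec, ed, 0, 0; ed, 0, 0, 0; 0, 0, 0, 0]
  -- a² = c, ab = d
  | .J12 => !![ec, ed, 0, 0; ed, 0, 0, 0; 0, 0, 0, 0; 0, 0, 0, 0]
  -- a² = c, b² = α c, ab = d
  | .J13 α => !![ec, ed, 0, 0; ed, sgn α • ec, 0, 0; 0, 0, 0, 0; 0, 0, 0, 0]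

theorem table_symm (l : Label) (i j : Fin 4) : table l i j = table l j i := by
  cases l <;> fin_cases i <;> fin_cases j <;> rfl

/-- The algebra with name `l`: the vector space `ℝ⁴` with the bilinear product given on the
standard basis by `table l`. -/
def Model (_l : Label) : Type := Fin 4 → ℝ

instance (l : Label) : AddCommGroup (Model l) := inferInstanceAs (AddCommGroup (Fin 4 → ℝ))

instance (l : Label) : Module ℝ (Model l) := inferInstanceAs (Module ℝ (Fin 4 → ℝ))

/-- The product of `Model l`. -/
def Model.mul {l : Label} (x y : Model l) : Model l :=
  fun k => ∑ i : Fin 4, ∑ j : Fin 4, x i * y j * table l i j k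

instance (l : Label) : Mul (Model l) := ⟨Model.mul⟩

theorem Model.mul_apply {l : Label} (x y : Model l) (k : Fin 4) :
    (x * y) k = ∑ i : Fin 4, ∑ j : Fin 4, x i * y j * table l i j k := rfl

theorem Model.add_apply {l : Label} (x y : Model l) (k : Fin 4) : (x + y) k = x k + y k := rfl

theorem Model.zero_apply {l : Label} (k : Fin 4) : (0 : Model l) k = 0 := rfl

theorem Model.smul_apply {l : Label} (r : ℝ) (x : Model l) (k : Fin 4) :
    (r • x) k = r * x k := rfl

instance (l : Label) : NonUnitalNonAssocCommRing (Model l) where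
  left_distrib x y z := by
    funext k
    simp only [Model.mul_apply, Model.add_apply, mul_add, add_mul, Finset.sum_add_distrib]
  right_distrib x y z := by
    funext k
    simp only [Model.mul_apply, Model.add_apply, add_mul, Finset.sum_add_distrib]
  zero_mul x := by
    funext k
    simp [Model.mul_apply, Model.zero_apply]
  mul_zero x := by
    funext k
    simp [Model.mul_apply, Model.zero_apply]
  mul_comm x y := by
    funext k
    rw [Model.mul_apply, Model.mul_apply, Finset.sum_comm]
    refine Finset.sum_congr rfl fun i _ => Finset.sum_congr rfl fun j _ => ?_
    rw [table_symm l j i, mul_comm (x j) (y i)]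

instance (l : Label) : IsScalarTower ℝ (Model l) (Model l) where
  smul_assoc r x y := by
    funext k
    simp only [smul_eq_mul, Model.mul_apply, Model.smul_apply, Finset.mul_sum, mul_assoc]

instance (l : Label) : SMulCommClass ℝ (Model l) (Model l) where
  smul_comm r x y := by
    rw [smul_eq_mul, smul_eq_mul, mul_comm x (r • y), mul_comm x y, ← smul_eq_mul (r • y) x,
      smul_assoc, smul_eq_mul]

/-- The twelve names of the classification of commutative nilpotent associative algebras. -/
def associativeLabels : Finset Label :=
  {.J1, .J2, .J3 1, .J3 (-1), .J4,
   .J5 1, .J5 (-1), .J7, .J11, .J12, .J13 1, .J13 (-1)}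

/-- The five names among these twelve that are listed as having a central component. -/
def centralComponentLabels : Finset Label := {.J1, .J2, .J3 1, .J3 (-1), .J4}

end RealNilpotentJordan

end

/-! Existence. In dimension 4 the lower central series drops strictly until it is zero, so all
products of five elements vanish. The classification is by the largest `n` for which some `x` has
nonzero `n`-th power. Polarization over `ℝ` turns the vanishing of powers into the vanishing of
mixed products. For `n = 4` the powers of `x` form a basis (`isIsomorphic_J11`). For `n = 3` the
vectors `x, x², x³` are completed by some `z` with `xz = 0`, and `z²` is then a multiple of `x³`
(`isIsomorphic_J4_or_J7`). For `n = 1` the product is zero. For `n = 2` all triple products vanish,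
so the product is a symmetric bilinear map into the annihilator. If all squares are proportional,
this map is a single real form, classified by rank and by signature up to an overall sign: `J2`,
`J3`, `J5` (`exists_isIsomorphic_of_rank_one`). If two squares `x², y²` are independent, then `x, y,
x², y²` is a basis, and modulo the annihilator the product looks like that of `ℂ`, `ℝ × ℝ` or the
dual numbers: `J13 (-1)`, `J13 1`, `J12` (`exists_isIsomorphic_of_rank_two`).

Uniqueness. Having a central component, together with seven elementary properties about vanishing
products (`Invariant`), separates the twelve models. The rest is evaluation of multiplication
tables. -/

set_option linter.unusedSimpArgs false

namespace RealNilpotentJordan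

/-! ### The models -/

section Models

variable {l : Label}

@[ext]
theorem Model.ext {x y : Model l} (h : ∀ k, x k = y k) : x = y := funext h

/-- An element of `Model l` given by its coordinates. -/
def Model.mk (l : Label) (p q r s : ℝ) : Model l := (![p, q, r, s] : Fin 4 → ℝ)

@[simp] theorem Model.mk_zero (p q r s : ℝ) : Model.mk l p q r s 0 = p := rfl
@[simp] theorem Model.mk_one (p q r s : ℝ) : Model.mk l p q r s 1 = q := rfl
@[simp] theorem Model.mk_two (p q r s : ℝ) : Model.mk l p q r s 2 = r := rfl
@[simp] theorem Model.mk_three (p q r s : ℝ) : Model.mk l p q r s 3 = s := rfl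

theorem Model.ext_iff_four {x y : Model l} :
    x = y ↔ x 0 = y 0 ∧ x 1 = y 1 ∧ x 2 = y 2 ∧ x 3 = y 3 := by
  constructor
  · rintro rfl
    simp
  · rintro ⟨h0, h1, h2, h3⟩
    ext k
    fin_cases k <;> assumption

@[simp] theorem sgn_one : sgn 1 = 1 := by simp [sgn]
@[simp] theorem sgn_neg_one : sgn (-1) = -1 := by simp [sgn]

theorem finrank_model (l : Label) : Module.finrank ℝ (Model l) = 4 := by
  change Module.finrank ℝ (Fin 4 → ℝ) = 4
  simp

/-- The bases are ordered so that every product involves only basis vectors strictly after each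
factor. Hence each step of the lower central series kills one more leading coordinate. -/
theorem table_apply_eq_zero (l : Label) (i j k : Fin 4) (h : k ≤ i) : table l i j k = 0 := by
  cases l <;> fin_cases i <;> fin_cases j <;> fin_cases k <;>
    first
    | exact absurd h (by decide)
    | simp [table, eb, ec, ed]

theorem lowerCentral_model_apply (l : Label) (m : ℕ) (x : Model l)
    (hx : x ∈ lowerCentral (Model l) m) (k : Fin 4) (hk : (k : ℕ) < m) : x k = 0 := by
  induction m generalizing x k with
  | zero => omega
  | succ m ih =>
    induction hx using Submodule.span_induction with
    | mem z hz =>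
      obtain ⟨u, hu, v, rfl⟩ := hz
      rw [Model.mul_apply]
      refine Finset.sum_eq_zero fun i _ => Finset.sum_eq_zero fun j _ => ?_
      by_cases hi : (i : ℕ) < m
      · simp [ih u hu i hi]
      · rw [table_apply_eq_zero l i j k (Fin.le_def.2 (by omega)), mul_zero]
    | zero => rfl
    | add u v _ _ hu hv => rw [Model.add_apply, hu, hv, add_zero]
    | smul r u _ hu => rw [Model.smul_apply, hu, mul_zero]

theorem isNilpotentAlgebra_model (l : Label) : IsNilpotentAlgebra (Model l) :=
  ⟨4, (Submodule.eq_bot_iff _).2 fun x hx =>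
    Model.ext fun k => lowerCentral_model_apply l 4 x hx k k.isLt⟩

theorem isCommJordan_model (l : Label) : IsCommJordan (Model l) := by
  constructor
  intro x y
  rw [Model.ext_iff_four]
  cases l <;>
    simp [Model.mul_apply, Fin.sum_univ_four, table, eb, ec, ed] <;> ring

theorem mul_assoc_of_mem {l : Label} (hl : l ∈ associativeLabels) (x y z : Model l) :
    x * y * z = x * (y * z) := by
  rw [Model.ext_iff_four]
  simp only [associativeLabels, Finset.mem_insert, Finset.mem_singleton] at hl
  rcases hl with rfl | rfl | rfl | rfl | rfl | rfl | rfl | rfl | rfl | rfl | rfl | rfl <;>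
    simp [Model.mul_apply, Fin.sum_univ_four, table, eb, ec, ed] <;>
    first
    | ring1
    | (constructor <;> ring1)

/-- Failing triples: `(aa)c = d` but `a(ac) = 0` in `J6`; `(bb)a = ±d` but `b(ba) = 0` in `J8`,
`J9`, `J10`. -/
theorem mem_of_mul_assoc (l : Label) (h : ∀ x y z : Model l, x * y * z = x * (y * z)) :
    l ∈ associativeLabels := by
  cases l with
  | J6 =>
    have := congrFun (h (Model.mk _ 1 0 0 0) (Model.mk _ 1 0 0 0) (Model.mk _ 0 0 1 0)) 3
    simp [Model.mul_apply, Fin.sum_univ_four, table, eb, ec, ed] at this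
  | J8 α =>
    have := congrFun (h (Model.mk _ 0 1 0 0) (Model.mk _ 0 1 0 0) (Model.mk _ 1 0 0 0)) 3
    rcases Int.units_eq_one_or α with rfl | rfl <;>
    simp [Model.mul_apply, Fin.sum_univ_four, table, eb, ec, ed] at this
  | J9 =>
    have := congrFun (h (Model.mk _ 0 1 0 0) (Model.mk _ 0 1 0 0) (Model.mk _ 1 0 0 0)) 3
    simp [Model.mul_apply, Fin.sum_univ_four, table, eb, ec, ed] at this
  | J10 =>
    have := congrFun (h (Model.mk _ 0 1 0 0) (Model.mk _ 0 1 0 0) (Model.mk _ 1 0 0 0)) 3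
    simp [Model.mul_apply, Fin.sum_univ_four, table, eb, ec, ed] at this
  | J3 α => rcases Int.units_eq_one_or α with rfl | rfl <;> decide
  | J5 α => rcases Int.units_eq_one_or α with rfl | rfl <;> decide
  | J13 α => rcases Int.units_eq_one_or α with rfl | rfl <;> decide
  | _ => decide

/-- `Label` is a sum of nine points and four copies of the group of signs. -/
def labelEquiv : Label ≃ Fin 9 ⊕ Fin 4 × ℤˣ where
  toFun
    | .J1 => .inl 0
    | .J2 => .inl 1
    | .J4 => .inl 2
    | .J6 => .inl 3
    | .J7 => .inl 4
    | .J9 => .inl 5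
    | .J10 => .inl 6
    | .J11 => .inl 7
    | .J12 => .inl 8
    | .J3 α => .inr (0, α)
    | .J5 α => .inr (1, α)
    | .J8 α => .inr (2, α)
    | .J13 α => .inr (3, α)
  invFun
    | .inl 0 => .J1
    | .inl 1 => .J2
    | .inl 2 => .J4
    | .inl 3 => .J6
    | .inl 4 => .J7
    | .inl 5 => .J9
    | .inl 6 => .J10
    | .inl 7 => .J11
    | .inl 8 => .J12
    | .inr (0, α) => .J3 α
    | .inr (1, α) => .J5 α
    | .inr (2, α) => .J8 α
    | .inr (3, α) => .J13 α
  left_inv l := by cases l <;> rfl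
  right_inv := by
    rintro (i | ⟨i, α⟩) <;> fin_cases i <;> rfl

theorem card_label : Nat.card Label = 17 := by
  rw [Nat.card_congr labelEquiv, Nat.card_eq_fintype_card]
  rfl

/-! ### Central components -/

theorem hasCentralComponent_of_mem {l : Label} (hl : l ∈ centralComponentLabels) :
    HasCentralComponent (Model l) := by
  -- In these five tables `d` neither occurs in a product nor multiplies nontrivially, so the
  -- summands are the span of `a, b, c` and the line of `d`.
  have hI : ∀ x y : Model l, (x * y) 3 = 0 := by
    intro x y
    simp only [centralComponentLabels, Finset.mem_insert, Finset.mem_singleton] at hl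
    rcases hl with rfl | rfl | rfl | rfl | rfl <;>
      simp [Model.mul_apply, Fin.sum_univ_four, table, eb, ec, ed]
  have hA : ∀ x : Model l, x 0 = 0 → x 1 = 0 → x 2 = 0 → ∀ y, x * y = 0 := by
    intro x h0 h1 h2 y
    rw [Model.ext_iff_four]
    simp only [centralComponentLabels, Finset.mem_insert, Finset.mem_singleton] at hl
    rcases hl with rfl | rfl | rfl | rfl | rfl <;>
      simp [Model.mul_apply, Fin.sum_univ_four, table, eb, ec, ed, h0, h1, Model.zero_apply]
  refine ⟨{ carrier := {x | x 3 = 0}, add_mem' := ?_, zero_mem' := rfl, smul_mem' := ?_ },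
    { carrier := {x | x 0 = 0 ∧ x 1 = 0 ∧ x 2 = 0}, add_mem' := ?_,
      zero_mem' := ⟨rfl, rfl, rfl⟩, smul_mem' := ?_ },
    fun x _ y => ⟨hI x y, hI y x⟩, fun x hx y => ?_, ?_, ?_, fun x hx y => ?_⟩
  · intro x y hx hy
    simp_all [Model.add_apply]
  · intro r x hx
    simp_all [Model.smul_apply]
  · intro x y hx hy
    simp_all [Model.add_apply]
  · intro r x hx
    simp_all [Model.smul_apply]
  · rw [mul_comm y x, hA x hx.1 hx.2.1 hx.2.2]
    exact ⟨Submodule.zero_mem _, Submodule.zero_mem _⟩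
  · constructor
    · rw [Submodule.disjoint_def]
      intro x h3 h
      exact Model.ext_iff_four.2 ⟨h.1, h.2.1, h.2.2, h3⟩
    · rw [codisjoint_iff, Submodule.eq_top_iff']
      intro x
      rw [Submodule.mem_sup]
      refine ⟨Model.mk l (x 0) (x 1) (x 2) 0, rfl, Model.mk l 0 0 0 (x 3), ⟨rfl, rfl, rfl⟩, ?_⟩
      simp [Model.ext_iff_four, Model.add_apply]
  · rw [Submodule.ne_bot_iff]
    refine ⟨Model.mk l 0 0 0 1, ⟨rfl, rfl, rfl⟩, fun h => ?_⟩
    simpa [Model.zero_apply] using congrFun h 3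
  · rw [mul_comm y x, hA x hx.1 hx.2.1 hx.2.2]
    exact ⟨rfl, rfl⟩

/-- In a direct sum with a central component all products lie in the other summand, so an algebra
whose annihilator lies in the span of the products has no central component. -/
theorem not_hasCentralComponent {A : Type*} [NonUnitalNonAssocCommRing A] [Module ℝ A]
    (h : ∀ x : A, (∀ y, x * y = 0) → x ∈ Submodule.span ℝ {z | ∃ u v : A, z = u * v}) :
    ¬ HasCentralComponent A := by
  rintro ⟨I₁, I₂, h1, -, hc, hne, h2⟩
  obtain ⟨x, hx, hx0⟩ := (Submodule.ne_bot_iff _).1 hne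
  have hle : Submodule.span ℝ {z | ∃ u v : A, z = u * v} ≤ I₁ := by
    rw [Submodule.span_le]
    rintro _ ⟨u, v, rfl⟩
    obtain ⟨u1, hu1, u2, hu2, rfl⟩ := Submodule.mem_sup.1
      (hc.sup_eq_top ▸ Submodule.mem_top : u ∈ I₁ ⊔ I₂)
    rw [add_mul, (h2 u2 hu2 v).1, add_zero]
    exact (h1 u1 hu1 v).1
  exact hx0 (Submodule.disjoint_def.1 hc.disjoint x (hle (h x fun y => (h2 x hx y).1)) hx)

theorem mem_centralComponentLabels {l : Label} (hl : l ∈ associativeLabels)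
    (h : HasCentralComponent (Model l)) : l ∈ centralComponentLabels := by
  by_contra hn
  refine not_hasCentralComponent (fun x hx => ?_) h
  -- The annihilator is spanned by products in each remaining case: by `a²` and `ab` for `J12` and
  -- `J13`, by `a²` for `J5`, by `ab` for `J7`, by `ac` for `J11`.
  have key : x = x 2 • (Model.mk l 1 0 0 0 * Model.mk l 1 0 0 0) +
        x 3 • (Model.mk l 1 0 0 0 * Model.mk l 0 1 0 0) ∨
      x = x 3 • (Model.mk l 1 0 0 0 * Model.mk l 1 0 0 0) ∨
      x = x 3 • (Model.mk l 1 0 0 0 * Model.mk l 0 1 0 0) ∨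
      x = x 3 • (Model.mk l 1 0 0 0 * Model.mk l 0 0 1 0) →
      x ∈ Submodule.span ℝ {z | ∃ u v : Model l, z = u * v} := by
    have hs : ∀ (r : ℝ) (u v : Model l),
        r • (u * v) ∈ Submodule.span ℝ {z | ∃ u v : Model l, z = u * v} :=
      fun r u v => Submodule.smul_mem _ r (Submodule.subset_span ⟨u, v, rfl⟩)
    rintro (h | h | h | h) <;> rw [h]
    exacts [Submodule.add_mem _ (hs _ _ _) (hs _ _ _), hs _ _ _, hs _ _ _, hs _ _ _]
  have ha := hx (Model.mk l 1 0 0 0)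
  have hb := hx (Model.mk l 0 1 0 0)
  have hc := hx (Model.mk l 0 0 1 0)
  simp only [associativeLabels, Finset.mem_insert, Finset.mem_singleton] at hl
  rcases hl with rfl | rfl | rfl | rfl | rfl | rfl | rfl | rfl | rfl | rfl | rfl | rfl <;>
    first
    | exact absurd (by decide) hn
    | refine key ?_
      simp [Model.mul_apply, Fin.sum_univ_four, table, eb, ec, ed, Model.zero_apply,
        Model.ext_iff_four, Model.add_apply, Model.smul_apply] at ha hb hc ⊢
      simp [*]

theorem hasCentralComponent_iff {l : Label} (hl : l ∈ associativeLabels) :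
    HasCentralComponent (Model l) ↔ l ∈ centralComponentLabels :=
  ⟨mem_centralComponentLabels hl, hasCentralComponent_of_mem⟩

end Models

/-! ### Pairwise non-isomorphism -/

section Invariants

theorem IsIsomorphic.symm {A B : Type*} [NonUnitalNonAssocRing A] [Module ℝ A]
    [NonUnitalNonAssocRing B] [Module ℝ B] (h : IsIsomorphic A B) : IsIsomorphic B A := by
  obtain ⟨f, hf⟩ := h
  exact ⟨f.symm, fun x y => f.injective (by simp [hf])⟩

theorem HasCentralComponent.of_isIsomorphic {A B : Type*} [NonUnitalNonAssocRing A] [Module ℝ A]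
    [NonUnitalNonAssocRing B] [Module ℝ B] (h : IsIsomorphic A B)
    (hA : HasCentralComponent A) : HasCentralComponent B := by
  obtain ⟨f, hf⟩ := h
  obtain ⟨I₁, I₂, h1, h2, hc, hne, h3⟩ := hA
  have hI : ∀ I : Submodule ℝ A, (∀ x ∈ I, ∀ y : A, x * y ∈ I ∧ y * x ∈ I) →
      ∀ x ∈ I.map (f : A →ₗ[ℝ] B), ∀ y : B,
        x * y ∈ I.map (f : A →ₗ[ℝ] B) ∧ y * x ∈ I.map (f : A →ₗ[ℝ] B) := by
    rintro I hI _ ⟨x, hx, rfl⟩ y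
    obtain ⟨y, rfl⟩ := f.surjective y
    exact ⟨⟨x * y, (hI x hx y).1, hf x y⟩, ⟨y * x, (hI x hx y).2, hf y x⟩⟩
  refine ⟨I₁.map (f : A →ₗ[ℝ] B), I₂.map (f : A →ₗ[ℝ] B), hI I₁ h1, hI I₂ h2, ?_, ?_, ?_⟩
  · exact hc.map (Submodule.orderIsoMapComap f)
  · exact fun h => hne (Submodule.map_eq_bot_iff.1 h)
  · rintro _ ⟨x, hx, rfl⟩ y
    obtain ⟨y, rfl⟩ := f.surjective y
    constructor
    · exact (hf x y).symm.trans (by rw [(h3 x hx y).1, map_zero])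
    · exact (hf y x).symm.trans (by rw [(h3 x hx y).2, map_zero])

/-- A list of properties of an algebra that are invariant under isomorphism and separate the
models. -/
def Invariant (A : Type*) [NonUnitalNonAssocRing A] : Fin 7 → Prop
  | 0 => ∀ x y : A, x * y = 0
  | 1 => ∀ x y z : A, x * y * z = 0
  | 2 => ∀ x : A, x * x * x * x = 0
  | 3 => ∀ x : A, x * x = 0 → ∀ y, x * y = 0
  | 4 => ∀ x y : A, x * y = 0 → (∀ z, x * z = 0) ∨ ∀ z, y * z = 0
  | 5 => ∀ x y z : A, x * y = 0 → x * z = 0 → y * z = 0 →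
      (∀ t, x * t = 0) ∨ (∀ t, y * t = 0) ∨ ∀ t, z * t = 0
  | 6 => ∀ x y : A, x * x = 0 → y * y = 0 → x * y = 0

theorem Invariant.of_isIsomorphic {A B : Type*} [NonUnitalNonAssocRing A] [Module ℝ A]
    [NonUnitalNonAssocRing B] [Module ℝ B] (h : IsIsomorphic A B) (i : Fin 7)
    (hB : Invariant B i) : Invariant A i := by
  obtain ⟨f, hf⟩ := h
  fin_cases i <;> change ∀ x, _ at hB <;>
    simp only [f.surjective.forall, ← hf, map_eq_zero_iff _ f.injective] at hB <;> exact hB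

/-- Labels of models for which an invariant holds. -/
def holdsLabels : Fin 7 → Finset Label
  | 0 => {.J1}
  | 1 => {.J2, .J3 1, .J3 (-1), .J5 1, .J5 (-1), .J12, .J13 1, .J13 (-1)}
  | 2 => {.J7}
  | 3 => {.J2, .J3 1, .J5 1, .J13 1, .J13 (-1)}
  | 4 => {.J2, .J13 (-1)}
  | 5 => {.J13 1}
  | 6 => {.J12}

/-- Labels of models for which an invariant fails. -/
def failsLabels : Fin 7 → Finset Label
  | 0 => {.J2, .J3 1, .J3 (-1), .J4}
  | 1 => {.J4, .J7, .J11}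
  | 2 => {.J11}
  | 3 => {.J3 (-1), .J5 (-1), .J12}
  | 4 => {.J3 1, .J5 1, .J13 1}
  | 5 => {.J5 1}
  | 6 => {.J5 (-1)}

set_option maxHeartbeats 1000000 in
theorem invariant_of_mem (i : Fin 7) {l : Label} (hl : l ∈ holdsLabels i) :
    Invariant (Model l) i := by
  have e : ∀ {m : Label} (x y : Model m), x * y = 0 ↔ (x * y) 0 = 0 ∧ (x * y) 1 = 0 ∧
      (x * y) 2 = 0 ∧ (x * y) 3 = 0 := fun x y => Model.ext_iff_four
  match i with
  | 0 =>
    simp only [holdsLabels, Finset.mem_singleton] at hl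
    subst hl
    intro x y
    simp [e, Model.mul_apply, table]
  | 1 =>
    simp only [holdsLabels, Finset.mem_insert, Finset.mem_singleton] at hl
    rcases hl with rfl | rfl | rfl | rfl | rfl | rfl | rfl | rfl <;> intro x y z <;>
      simp [e, Model.mul_apply, Fin.sum_univ_four, table, eb, ec, ed]
  | 2 =>
    simp only [holdsLabels, Finset.mem_singleton] at hl
    subst hl
    intro x
    simp [e, Model.mul_apply, Fin.sum_univ_four, table, eb, ec, ed]
  | 3 =>
    simp only [holdsLabels, Finset.mem_insert, Finset.mem_singleton] at hl
    rcases hl with rfl | rfl | rfl | rfl | rfl <;> intro x h y <;>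
      simp [e, Model.mul_apply, Fin.sum_univ_four, table, eb, ec, ed] at h ⊢
    · simp [h]
    · have h0 : x 0 = 0 := by nlinarith [sq_nonneg (x 0), sq_nonneg (x 1)]
      have h1 : x 1 = 0 := by nlinarith [sq_nonneg (x 0), sq_nonneg (x 1)]
      simp [h0, h1]
    · have h0 : x 0 = 0 := by nlinarith [sq_nonneg (x 0), sq_nonneg (x 1), sq_nonneg (x 2)]
      have h1 : x 1 = 0 := by nlinarith [sq_nonneg (x 0), sq_nonneg (x 1), sq_nonneg (x 2)]
      have h2 : x 2 = 0 := by nlinarith [sq_nonneg (x 0), sq_nonneg (x 1), sq_nonneg (x 2)]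
      simp [h0, h1, h2]
    · have h0 : x 0 = 0 := by nlinarith [sq_nonneg (x 0), sq_nonneg (x 1)]
      have h1 : x 1 = 0 := by nlinarith [sq_nonneg (x 0), sq_nonneg (x 1)]
      simp [h0, h1]
    · have h2 : x 0 * x 1 = 0 := by linarith [h.2]
      rcases mul_eq_zero.1 h2 with h0 | h0 <;> simp [h0] at h ⊢ <;> simp [h]
  | 4 =>
    simp only [holdsLabels, Finset.mem_insert, Finset.mem_singleton] at hl
    rcases hl with rfl | rfl <;> intro x y h <;>
      simp [e, Model.mul_apply, Fin.sum_univ_four, table, eb, ec, ed] at h ⊢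
    · rcases h with h | h <;> simp [h]
    -- On the first two coordinates the product of `J13 (-1)` is complex multiplication, and this is
    -- multiplicativity of the norm.
    · have h2 : (x 0 ^ 2 + x 1 ^ 2) * (y 0 ^ 2 + y 1 ^ 2) = 0 := by
        linear_combination (x 0 * y 0 - x 1 * y 1) * h.1 + (x 0 * y 1 + x 1 * y 0) * h.2
      rcases mul_eq_zero.1 h2 with h2 | h2
      · left
        have h0 : x 0 = 0 := by nlinarith [sq_nonneg (x 0), sq_nonneg (x 1)]
        have h1 : x 1 = 0 := by nlinarith [sq_nonneg (x 0), sq_nonneg (x 1)]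
        simp [h0, h1]
      · right
        have h0 : y 0 = 0 := by nlinarith [sq_nonneg (y 0), sq_nonneg (y 1)]
        have h1 : y 1 = 0 := by nlinarith [sq_nonneg (y 0), sq_nonneg (y 1)]
        simp [h0, h1]
  | 5 =>
    simp only [holdsLabels, Finset.mem_singleton] at hl
    subst hl
    -- The sum and difference of the first two coordinates turn the product of `J13 1` into that of
    -- `ℝ × ℝ`. Among three pairwise orthogonal elements at most one is nonzero in each factor, so
    -- one of the three vanishes in both.
    have aux : ∀ {p q r p' q' r' : Prop}, (p ∨ q) ∧ (p' ∨ q') → (p ∨ r) ∧ (p' ∨ r') →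
        (q ∨ r) ∧ (q' ∨ r') → p ∧ p' ∨ q ∧ q' ∨ r ∧ r' := by
      tauto
    have h2 : ∀ x y : Model (.J13 1), x * y = 0 →
        (x 0 + x 1 = 0 ∨ y 0 + y 1 = 0) ∧ (x 0 - x 1 = 0 ∨ y 0 - y 1 = 0) := by
      intro x y h
      simp [e, Model.mul_apply, Fin.sum_univ_four, table, eb, ec, ed] at h
      rw [← mul_eq_zero, ← mul_eq_zero]
      constructor <;> linarith [h.1, h.2]
    have h3 : ∀ x : Model (.J13 1), x 0 + x 1 = 0 → x 0 - x 1 = 0 → ∀ y, x * y = 0 := by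
      intro x hs hd y
      have h0 : x 0 = 0 := by linarith
      have h1 : x 1 = 0 := by linarith
      simp [e, Model.mul_apply, Fin.sum_univ_four, table, eb, ec, ed, h0, h1]
    intro x y z hxy hxz hyz
    exact (aux (h2 x y hxy) (h2 x z hxz) (h2 y z hyz)).imp (fun h => h3 x h.1 h.2)
      (Or.imp (fun h => h3 y h.1 h.2) fun h => h3 z h.1 h.2)
  | 6 =>
    simp only [holdsLabels, Finset.mem_singleton] at hl
    subst hl
    intro x y hx hy
    simp [e, Model.mul_apply, Fin.sum_univ_four, table, eb, ec, ed] at hx hy ⊢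
    simp [hx, hy]

theorem not_invariant_of_mem (i : Fin 7) {l : Label} (hl : l ∈ failsLabels i) :
    ¬ Invariant (Model l) i := by
  match i with
  | 0 =>
    intro h
    have h1 := h (Model.mk l 1 0 0 0) (Model.mk l 1 0 0 0)
    simp only [failsLabels, Finset.mem_insert, Finset.mem_singleton] at hl
    rcases hl with rfl | rfl | rfl | rfl <;>
      simp [Model.ext_iff_four, Model.mul_apply, Fin.sum_univ_four, table, eb, ec, ed,
        Model.zero_apply] at h1
  | 1 =>
    intro h
    have h1 := h (Model.mk l 1 0 0 0) (Model.mk l 1 0 0 0) (Model.mk l 1 0 0 0)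
    simp only [failsLabels, Finset.mem_insert, Finset.mem_singleton] at hl
    rcases hl with rfl | rfl | rfl <;>
      simp [Model.ext_iff_four, Model.mul_apply, Fin.sum_univ_four, table, eb, ec, ed,
        Model.zero_apply] at h1
  | 2 =>
    intro h
    have h1 := h (Model.mk l 1 0 0 0)
    simp only [failsLabels, Finset.mem_singleton] at hl
    subst hl
    simp [Model.ext_iff_four, Model.mul_apply, Fin.sum_univ_four, table, eb, ec, ed,
      Model.zero_apply] at h1
  | 3 =>
    intro h
    simp only [failsLabels, Finset.mem_insert, Finset.mem_singleton] at hl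
    rcases hl with rfl | rfl | rfl
    · have h1 := h (Model.mk _ 1 1 0 0)
      have h2 := fun h => h1 h (Model.mk _ 1 0 0 0)
      simp [Model.ext_iff_four, Model.mul_apply, Fin.sum_univ_four, table, eb, ec, ed,
        Model.zero_apply] at h2
    · have h1 := h (Model.mk _ 1 0 1 0)
      have h2 := fun h => h1 h (Model.mk _ 1 0 0 0)
      simp [Model.ext_iff_four, Model.mul_apply, Fin.sum_univ_four, table, eb, ec, ed,
        Model.zero_apply] at h2
    · have h1 := h (Model.mk _ 0 1 0 0)
      have h2 := fun h => h1 h (Model.mk _ 1 0 0 0)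
      simp [Model.ext_iff_four, Model.mul_apply, Fin.sum_univ_four, table, eb, ec, ed,
        Model.zero_apply] at h2
  | 4 =>
    intro h
    -- `(a + b)(a - b) = a² - b² = 0` if `a² = b²`.
    have h1 := fun h0 => (h (Model.mk l 1 1 0 0) (Model.mk l 1 (-1) 0 0) h0).imp
      (fun h => h (Model.mk l 1 0 0 0)) fun h => h (Model.mk l 1 0 0 0)
    simp only [failsLabels, Finset.mem_insert, Finset.mem_singleton] at hl
    rcases hl with rfl | rfl | rfl <;>
      simp [Model.ext_iff_four, Model.mul_apply, Fin.sum_univ_four, table, eb, ec, ed,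
        Model.zero_apply] at h1
  | 5 =>
    intro h
    have h1 := fun h0 h1 h2 => (h (Model.mk l 1 0 0 0) (Model.mk l 0 1 0 0)
      (Model.mk l 0 0 1 0) h0 h1 h2).imp (fun h => h (Model.mk l 1 0 0 0))
      (Or.imp (fun h => h (Model.mk l 0 1 0 0)) fun h => h (Model.mk l 0 0 1 0))
    simp only [failsLabels, Finset.mem_singleton] at hl
    subst hl
    simp [Model.ext_iff_four, Model.mul_apply, Fin.sum_univ_four, table, eb, ec, ed,
      Model.zero_apply] at h1
  | 6 =>
    intro h
    have h1 := h (Model.mk l 1 0 1 0) (Model.mk l 1 0 (-1) 0)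
    simp only [failsLabels, Finset.mem_singleton] at hl
    subst hl
    simp [Model.ext_iff_four, Model.mul_apply, Fin.sum_univ_four, table, eb, ec, ed,
      Model.zero_apply] at h1

theorem labels_separated : ∀ l ∈ associativeLabels, ∀ l' ∈ associativeLabels,
    (l ∈ centralComponentLabels ↔ l' ∈ centralComponentLabels) →
    (∀ i, ¬ (l ∈ holdsLabels i ∧ l' ∈ failsLabels i)) →
    (∀ i, ¬ (l' ∈ holdsLabels i ∧ l ∈ failsLabels i)) → l = l' := by
  decide

theorem eq_of_isIsomorphic_model {l l' : Label} (hl : l ∈ associativeLabels)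
    (hl' : l' ∈ associativeLabels) (h : IsIsomorphic (Model l) (Model l')) : l = l' := by
  refine labels_separated l hl l' hl' ?_ (fun i hi => ?_) fun i hi => ?_
  · rw [← hasCentralComponent_iff hl, ← hasCentralComponent_iff hl']
    exact ⟨.of_isIsomorphic h, .of_isIsomorphic h.symm⟩
  · exact not_invariant_of_mem i hi.2 (.of_isIsomorphic h.symm i (invariant_of_mem i hi.1))
  · exact not_invariant_of_mem i hi.2 (.of_isIsomorphic h i (invariant_of_mem i hi.1))

end Invariants

/-! ### The lower central series of a nilpotent algebra -/

section LowerCentral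

variable {A : Type*} [NonUnitalNonAssocRing A] [Module ℝ A]

theorem mul_mem_lowerCentral {m : ℕ} {x : A} (hx : x ∈ lowerCentral A m) (y : A) :
    x * y ∈ lowerCentral A (m + 1) :=
  Submodule.subset_span ⟨x, hx, y, rfl⟩

theorem lowerCentral_succ_le (m : ℕ) : lowerCentral A (m + 1) ≤ lowerCentral A m := by
  induction m with
  | zero => exact le_top
  | succ m ih =>
    refine Submodule.span_mono ?_
    rintro _ ⟨x, hx, y, rfl⟩
    exact ⟨x, ih hx, y, rfl⟩

/-- Each term determines the next, so a series that pauses once is constant from there on, and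
nilpotency makes that constant zero. -/
theorem lowerCentral_eq_bot_of_succ_eq (hA : IsNilpotentAlgebra A) {m : ℕ}
    (h : lowerCentral A (m + 1) = lowerCentral A m) : lowerCentral A m = ⊥ := by
  have hk : ∀ k, lowerCentral A (m + k) = lowerCentral A m := by
    intro k
    induction k with
    | zero => rfl
    | succ k ih =>
      rw [← add_assoc, ← h, lowerCentral, ih, lowerCentral]
  obtain ⟨n, hn⟩ := hA
  have hanti : Antitone (lowerCentral A) := antitone_nat_of_succ_le lowerCentral_succ_le
  rw [← hk n, eq_bot_iff, ← hn]
  exact hanti (Nat.le_add_left n m)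

theorem lowerCentral_finrank_eq_bot [FiniteDimensional ℝ A] (hA : IsNilpotentAlgebra A) :
    lowerCentral A (Module.finrank ℝ A) = ⊥ := by
  have key : ∀ m, Module.finrank ℝ (lowerCentral A m) ≤ Module.finrank ℝ A - m := by
    intro m
    induction m with
    | zero => exact Submodule.finrank_le _
    | succ m ih =>
      by_cases h : lowerCentral A (m + 1) = lowerCentral A m
      · rw [h, lowerCentral_eq_bot_of_succ_eq hA h]
        simp
      · have := Submodule.finrank_lt_finrank_of_lt (lt_of_le_of_ne (lowerCentral_succ_le m) h)
        omega
  rw [← Submodule.finrank_eq_zero (R := ℝ)]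
  simpa using key (Module.finrank ℝ A)

end LowerCentral

/-! ### Quadruples of vectors -/

section Independent

variable {V : Type*} [AddCommGroup V] [Module ℝ V]

theorem linearIndependent_four_iff {a b c d : V} :
    LinearIndependent ℝ ![a, b, c, d] ↔ ∀ p q r s : ℝ,
      p • a + q • b + r • c + s • d = 0 → p = 0 ∧ q = 0 ∧ r = 0 ∧ s = 0 := by
  rw [Fintype.linearIndependent_iff]
  constructor
  · intro h p q r s hs
    have := h ![p, q, r, s] (by simpa [Fin.sum_univ_four] using hs)
    exact ⟨this 0, this 1, this 2, this 3⟩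
  · intro h g hg i
    have := h (g 0) (g 1) (g 2) (g 3) (by simpa [Fin.sum_univ_four] using hg)
    fin_cases i
    exacts [this.1, this.2.1, this.2.2.1, this.2.2.2]

theorem exists_eq_of_linearIndependent (hV : Module.finrank ℝ V = 4) {a b c d : V}
    (h : LinearIndependent ℝ ![a, b, c, d]) (x : V) :
    ∃ p q r s : ℝ, x = p • a + q • b + r • c + s • d := by
  have hs := h.span_eq_top_of_card_eq_finrank (by simp [hV])
  have hx : x ∈ Submodule.span ℝ (Set.range ![a, b, c, d]) := hs ▸ Submodule.mem_top
  obtain ⟨g, hg⟩ := (Submodule.mem_span_range_iff_exists_fun ℝ).1 hx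
  exact ⟨g 0, g 1, g 2, g 3, by simpa [Fin.sum_univ_four] using hg.symm⟩

theorem exists_linearIndependent_cons {n : ℕ} (hV : n < Module.finrank ℝ V) {v : Fin n → V}
    (h : LinearIndependent ℝ v) : ∃ x, LinearIndependent ℝ (Fin.cons x v : Fin (n + 1) → V) := by
  have : FiniteDimensional ℝ V := Module.finite_of_finrank_pos (by omega)
  obtain ⟨x, hx⟩ : ∃ x, x ∉ Submodule.span ℝ (Set.range v) := by
    by_contra! hn
    have h1 := finrank_span_eq_card h
    rw [(Submodule.eq_top_iff'.2 hn), finrank_top, Fintype.card_fin] at h1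
    omega
  exact ⟨x, linearIndependent_finCons.2 ⟨h, hx⟩⟩

theorem isIsomorphic_of_table {A : Type*} [NonUnitalNonAssocRing A] [Module ℝ A]
    [IsScalarTower ℝ A A] [SMulCommClass ℝ A A] (hA : Module.finrank ℝ A = 4) (l : Label)
    {v : Fin 4 → A} (hv : LinearIndependent ℝ v)
    (h : ∀ i j, v i * v j = ∑ k, table l i j k • v k) : IsIsomorphic A (Model l) := by
  let e := basisOfLinearIndependentOfCardEqFinrank hv (by simp [hA])
  have he : ∀ i, e i = v i := fun i => by simp [e]
  let f : A ≃ₗ[ℝ] Model l := e.equivFun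
  have hf : ∀ x : Model l, f.symm x = ∑ i, x i • v i := by
    intro x
    refine (e.equivFun_symm_apply x).trans ?_
    simp [he]
  have hmul : ∀ x y : Model l, f.symm (x * y) = f.symm x * f.symm y := by
    intro x y
    simp only [hf, Finset.sum_mul_sum, smul_mul_assoc, mul_smul_comm, h, Model.mul_apply,
      Finset.sum_smul, Finset.smul_sum, smul_smul]
    rw [Finset.sum_comm]
    refine Finset.sum_congr rfl fun i _ => ?_
    rw [Finset.sum_comm]
    refine Finset.sum_congr rfl fun j _ => Finset.sum_congr rfl fun k _ => ?_
    congr 1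
    ring
  refine ⟨f, fun x y => ?_⟩
  apply f.symm.injective
  rw [hmul]
  simp

end Independent

/-! ### Polarization -/

section Polarization

variable {A : Type*} [NonUnitalCommRing A] [Module ℝ A] [IsScalarTower ℝ A A]
  [SMulCommClass ℝ A A]

theorem mul_eq_zero_of_sq {A : Type*} [NonUnitalCommRing A] [Module ℝ A] (h : ∀ x : A, x * x = 0) (x y : A) : x * y = 0 := by
  have h1 := h (x + y)
  simp only [mul_add, add_mul, h x, h y, mul_comm y x] at h1
  have h2 : (2 : ℝ) • (x * y) = 0 := by
    rw [← h1]; module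
  exact (smul_eq_zero_iff_right (by norm_num)).1 h2

theorem mul_mul_eq_zero_of_cube {A : Type*} [NonUnitalCommRing A] [Module ℝ A]
    (h : ∀ x : A, x * (x * x) = 0) (x y z : A) :
    x * (y * z) = 0 := by
  have h2 : ∀ x y : A, x * (y * y) = 0 := by
    intro x y
    have h1 := h (x + y)
    have h3 := h (x - y)
    simp only [mul_add, add_mul, mul_sub, sub_mul, h x, h y, mul_comm y x, mul_left_comm y x] at h1 h3
    -- `(x + y)³ + (x - y)³ = 2x³ + 6xy²`.
    have h2 : (6 : ℝ) • (x * (y * y)) = 0 := by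
      linear_combination (norm := module) h1 + h3
    exact (smul_eq_zero_iff_right (by norm_num)).1 h2
  have h1 := h2 x (y + z)
  simp only [mul_add, add_mul, h2, mul_comm z y] at h1
  have h2 : (2 : ℝ) • (x * (y * z)) = 0 := by
    rw [← h1]; module
  exact (smul_eq_zero_iff_right (by norm_num)).1 h2

theorem mul_cube_eq_zero_of_fourth (h : ∀ x : A, x * (x * (x * x)) = 0) (x y : A) :
    y * (x * (x * x)) = 0 := by
  -- `(x + y)⁴ - (x - y)⁴ = 8(x³y + xy³)`. Replacing `x` by `2x` then separates the two terms, which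
  -- have different degrees in `x`.
  have key : ∀ x y : A, y * (x * (x * x)) + x * (y * (y * y)) = 0 := by
    intro x y
    have h1 := h (x + y)
    have h3 := h (x - y)
    simp only [mul_add, add_mul, mul_sub, sub_mul, h x, h y, mul_comm y x, mul_left_comm y x] at h1 h3
    have h2 : (8 : ℝ) • (y * (x * (x * x)) + x * (y * (y * y))) = 0 := by
      simp only [mul_comm y x, mul_left_comm y x]
      linear_combination (norm := module) h1 - h3
    exact (smul_eq_zero_iff_right (by norm_num)).1 h2
  have h1 := key x y
  have h2 := key ((2 : ℝ) • x) y
  simp only [smul_mul_assoc, mul_smul_comm] at h2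
  have h3 : (6 : ℝ) • (y * (x * (x * x))) = 0 := by
    linear_combination (norm := module) h2 - (2 : ℝ) • h1
  exact (smul_eq_zero_iff_right (by norm_num)).1 h3

end Polarization

/-! ### The classification -/

section Classification

variable {A : Type*} [NonUnitalCommRing A] [Module ℝ A] [IsScalarTower ℝ A A]
  [SMulCommClass ℝ A A]

/-- A convenient form of `isIsomorphic_of_table`: a basis `a, b, c, d` with `d` annihilating, and
the six other products. -/
theorem isIsomorphic_of_products (hA : Module.finrank ℝ A = 4) (l : Label) {a b c d : A}
    (hv : LinearIndependent ℝ ![a, b, c, d]) (hd : ∀ x, d * x = 0)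
    (hl : ∀ i, table l 3 i = 0)
    (haa : a * a = ∑ k, table l 0 0 k • ![a, b, c, d] k)
    (hab : a * b = ∑ k, table l 0 1 k • ![a, b, c, d] k)
    (hac : a * c = ∑ k, table l 0 2 k • ![a, b, c, d] k)
    (hbb : b * b = ∑ k, table l 1 1 k • ![a, b, c, d] k)
    (hbc : b * c = ∑ k, table l 1 2 k • ![a, b, c, d] k)
    (hcc : c * c = ∑ k, table l 2 2 k • ![a, b, c, d] k) : IsIsomorphic A (Model l) := by
  refine isIsomorphic_of_table hA l hv fun i j => ?_
  have hd' : ∀ i, ![a, b, c, d] i * d = 0 := fun i => by rw [mul_comm, hd]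
  have hl' : ∀ i, table l i 3 = 0 := fun i => by rw [table_symm, hl]
  have h10 := table_symm l 1 0
  have h20 := table_symm l 2 0
  have h21 := table_symm l 2 1
  fin_cases i <;> fin_cases j <;>
    simp_all [Fin.sum_univ_four, mul_comm b a, mul_comm c a, mul_comm c b, mul_comm _ d]

theorem exists_linearIndependent_pair {V : Type*} [AddCommGroup V] [Module ℝ V]
    (hA : Module.finrank ℝ V = 4) {x y : V}
    (h : LinearIndependent ℝ ![x, y]) : ∃ z w, LinearIndependent ℝ ![x, y, z, w] := by
  obtain ⟨z, hz⟩ := exists_linearIndependent_cons (by omega) h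
  obtain ⟨w, hw⟩ := exists_linearIndependent_cons (by omega) hz
  refine ⟨z, w, ?_⟩
  rw [linearIndependent_four_iff]
  rw [Fintype.linearIndependent_iff] at hw
  intro p q r s hs
  have := hw ![s, r, p, q] (by
    rw [← hs]
    simp [Fin.sum_univ_four]
    abel)
  exact ⟨this 2, this 3, this 1, this 0⟩

theorem smul_eq_zero_left {V : Type*} [AddCommGroup V] [Module ℝ V] {r : ℝ} {x : V} (hx : x ≠ 0)
    (h : r • x = 0) : r = 0 :=
  (smul_eq_zero.1 h).resolve_right hx

theorem mul_eq_zero_of_basis {A : Type*} [NonUnitalCommRing A] [Module ℝ A] [SMulCommClass ℝ A A]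
    (hA : Module.finrank ℝ A = 4) {a b c d w : A}
    (hv : LinearIndependent ℝ ![a, b, c, d]) (ha : w * a = 0) (hb : w * b = 0) (hc : w * c = 0)
    (hd : w * d = 0) (x : A) : w * x = 0 := by
  obtain ⟨p, q, r, s, rfl⟩ := exists_eq_of_linearIndependent hA hv x
  simp only [mul_add, mul_smul_comm, ha, hb, hc, hd, smul_zero, add_zero]

theorem exists_sgn_mul_sq {r : ℝ} (hr : r ≠ 0) : ∃ (α : ℤˣ) (t : ℝ), t ≠ 0 ∧ r = sgn α * t ^ 2 := by
  rcases lt_or_gt_of_ne hr with h | h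
  · refine ⟨-1, √(-r), (Real.sqrt_pos.2 (by linarith)).ne', ?_⟩
    rw [Real.sq_sqrt (by linarith)]
    simp [sgn]
  · refine ⟨1, √r, (Real.sqrt_pos.2 h).ne', ?_⟩
    rw [Real.sq_sqrt h.le]
    simp [sgn]

/-- `x⁴ ≠ 0`. -/
theorem isIsomorphic_J11 (hA : Module.finrank ℝ A = 4)
    (h5 : ∀ x y z t u : A, x * y * z * t * u = 0) {x : A} (hx : x * (x * (x * x)) ≠ 0) :
    IsIsomorphic A (Model .J11) := by
  have h5' : ∀ y, x * (x * (x * x)) * y = 0 := fun y => by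
    rw [← h5 x x x x y]
    simp only [mul_assoc]
  have h5x : x * (x * (x * (x * x))) = 0 := by rw [mul_comm, h5']
  -- Independence follows by multiplying a relation by `x³`, `x²` and `x` in turn, which isolates
  -- the lowest remaining coefficient.
  refine isIsomorphic_of_products (a := x) (b := x * x) (c := x * (x * x))
    (d := x * (x * (x * x))) hA _ ?_ h5' (by intro i; fin_cases i <;> rfl) ?_ ?_ ?_ ?_ ?_ ?_
  · rw [linearIndependent_four_iff]
    intro p q r s h
    have h1 := congrArg (fun y => x * (x * (x * y))) h
    have h2 := congrArg (fun y => x * (x * y)) h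
    have h3 := congrArg (fun y => x * y) h
    simp only [mul_add, mul_smul_comm, h5x, smul_zero, add_zero, mul_zero] at h1 h2 h3
    obtain rfl := smul_eq_zero_left hx h1
    simp only [zero_smul, zero_add] at h h2 h3
    obtain rfl := smul_eq_zero_left hx h2
    simp only [zero_smul, zero_add] at h h3
    obtain rfl := smul_eq_zero_left hx h3
    simp only [zero_smul, zero_add] at h
    exact ⟨rfl, rfl, rfl, smul_eq_zero_left hx h⟩
  all_goals simp [Fin.sum_univ_four, table, eb, ec, ed, mul_assoc, h5x]

/-- `x³ ≠ 0` and all fourth powers vanish. -/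
theorem isIsomorphic_J4_or_J7 (hA : Module.finrank ℝ A = 4)
    (h4 : ∀ x y : A, y * (x * (x * x)) = 0) {x : A} (hx : x * (x * x) ≠ 0) :
    IsIsomorphic A (Model .J4) ∨ IsIsomorphic A (Model .J7) := by
  -- Multiplication by `x` has cube zero, since `x³` annihilates the algebra. Comparing coefficients
  -- in its third iterate on `y` below gives `s³ = 0` and then `p = 0`.
  have hxn : ∀ y, x * (x * (x * y)) = 0 := fun y => by
    rw [← h4 x y]
    simp only [mul_comm y, mul_assoc]
  have h3 : LinearIndependent ℝ ![x, x * x, x * (x * x)] := by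
    rw [Fintype.linearIndependent_iff]
    intro g hg
    simp only [Fin.sum_univ_three, Matrix.cons_val_zero, Matrix.cons_val_one,
      Matrix.cons_val] at hg
    have h1 := congrArg (fun y => x * (x * y)) hg
    have h2 := congrArg (fun y => x * y) hg
    simp only [mul_add, mul_smul_comm, hxn, smul_zero, add_zero, mul_zero] at h1 h2
    have e0 := smul_eq_zero_left hx h1
    simp only [e0, zero_smul, zero_add] at hg h2
    have e1 := smul_eq_zero_left hx h2
    simp only [e1, zero_smul, zero_add] at hg
    have e2 := smul_eq_zero_left hx hg
    intro i
    fin_cases i <;> assumption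
  obtain ⟨y, hy⟩ := exists_linearIndependent_cons (by omega) h3
  replace hy : LinearIndependent ℝ ![y, x, x * x, x * (x * x)] := hy
  obtain ⟨s, p, q, r, hxy⟩ := exists_eq_of_linearIndependent hA hy (x * y)
  rw [linearIndependent_four_iff] at hy
  have hxxy : x * (x * y) = (s * s) • y + (s * p) • x + (p + s * q) • (x * x) +
      (q + s * r) • (x * (x * x)) := by
    conv_lhs => rw [hxy]
    simp only [mul_add, mul_smul_comm, hxn, hxy]
    module
  have hxxxy : x * (x * (x * y)) = (s * s * s) • y + (s * s * p) • x + (s * (p + s * q)) • (x * x) +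
      (p + s * q + s * s * r) • (x * (x * x)) := by
    rw [hxxy]
    simp only [mul_add, mul_smul_comm, hxn, hxy]
    module
  rw [hxn] at hxxxy
  obtain ⟨e1, -, -, e2⟩ := hy _ _ _ _ hxxxy.symm
  have hs : s = 0 := by simpa using e1
  have hp : p = 0 := by simpa [hs] using e2
  subst hs hp
  -- Now `xy = q x² + r x³`, and this correction of `y` makes the product with `x` vanish.
  obtain ⟨z, hz⟩ : ∃ z, z = y - q • x - r • (x * x) := ⟨_, rfl⟩
  have hxz : x * z = 0 := by
    rw [hz, mul_sub, mul_sub, hxy]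
    simp only [mul_smul_comm]
    module
  have hzb : LinearIndependent ℝ ![z, x, x * x, x * (x * x)] := by
    rw [linearIndependent_four_iff]
    intro p' q' r' s' h
    have := hy p' (q' - p' * q) (r' - p' * r) s' (by rw [← h, hz]; module)
    obtain ⟨rfl, h1, h2, rfl⟩ := this
    refine ⟨rfl, ?_, ?_, rfl⟩ <;> linarith
  clear hxxxy hxxy hxy hz hy e1 e2
  obtain ⟨δ, α, β, γ, hzz⟩ := exists_eq_of_linearIndependent hA hzb (z * z)
  rw [linearIndependent_four_iff] at hzb
  have h1 : x * (z * z) = 0 := by rw [← mul_assoc, hxz, zero_mul]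
  rw [hzz] at h1
  simp only [mul_add, mul_smul_comm, hxn, hxz] at h1
  obtain ⟨-, -, rfl, rfl⟩ := hzb 0 0 α β (by rw [← h1]; module)
  have h2 : z * (z * (z * z)) = 0 := h4 z z
  have hzx : ∀ t, z * (x * t) = 0 := fun t => by rw [← mul_assoc, mul_comm z x, hxz, zero_mul]
  -- Hence `z⁴ = δ² z²`, whose `z`-coefficient is `δ³`; as fourth powers vanish, `δ = 0`.
  have h3' : z * (z * z) = δ • (z * z) := by
    conv_lhs => rw [hzz]
    simp only [mul_add, mul_smul_comm, hzx, mul_comm z x, hxz]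
    module
  rw [h3', mul_smul_comm, h3', hzz] at h2
  obtain ⟨hδ, -⟩ := hzb (δ * δ * δ) 0 0 (δ * δ * γ) (by rw [← h2]; module)
  have hδ : δ = 0 := by simpa using hδ
  subst hδ
  replace hzz : z * z = γ • (x * (x * x)) := by rw [hzz]; module
  have hzx0 : z * x = 0 := by rw [mul_comm, hxz]
  have h4' : ∀ y, x * (x * x) * y = 0 := fun y => by rw [mul_comm, h4]
  by_cases hγ : γ = 0
  · left
    have hz0 : z * z = 0 := by rw [hzz, hγ, zero_smul]
    refine isIsomorphic_of_products (a := x) (b := x * x) (c := x * (x * x)) (d := z) hA _ ?_ ?_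
      (by intro i; fin_cases i <;> rfl) ?_ ?_ ?_ ?_ ?_ ?_
    · rw [linearIndependent_four_iff]
      intro p q r s h
      have := hzb s p q r (by rw [← h]; module)
      tauto
    · exact mul_eq_zero_of_basis hA (linearIndependent_four_iff.2 hzb) hz0 hzx0 (hzx _) (hzx _)
    all_goals simp [Fin.sum_univ_four, table, eb, ec, mul_assoc, h4, hxn]
  · right
    -- The scaling gives `(γz)² = γ³x³ = (γx)(γ²x²)`.
    refine isIsomorphic_of_products (a := γ • x) (b := γ ^ 2 • (x * x)) (c := γ • z)
      (d := γ ^ 3 • (x * (x * x))) hA _ ?_ ?_ (by intro i; fin_cases i <;> rfl) ?_ ?_ ?_ ?_ ?_ ?_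
    · rw [linearIndependent_four_iff]
      intro p q r s h
      have := hzb (r * γ) (p * γ) (q * γ ^ 2) (s * γ ^ 3) (by rw [← h]; module)
      simp [hγ] at this
      tauto
    · intro t
      rw [smul_mul_assoc, h4', smul_zero]
    all_goals
      simp [Fin.sum_univ_four, table, eb, ed, mul_assoc, hxn, hxz, hzz, smul_smul,
        smul_mul_assoc, mul_smul_comm]
    all_goals try module

/-- A basis `x, y, x², y²` with annihilating squares. -/
theorem exists_isIsomorphic_J12_J13 (hA : Module.finrank ℝ A = 4)
    (h3 : ∀ x y z : A, x * (y * z) = 0) {x y : A} {γ δ : ℝ}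
    (hb : LinearIndependent ℝ ![x, y, x * x, y * y])
    (hxy : x * y = γ • (x * x) + δ • (y * y)) (hγ : γ ≠ 0) :
    IsIsomorphic A (Model .J12) ∨ ∃ α, IsIsomorphic A (Model (.J13 α)) := by
  rw [linearIndependent_four_iff] at hb
  have h3' : ∀ x y z : A, x * y * z = 0 := fun x y z => by rw [mul_comm, h3]
  -- The multiple of `y` is chosen so that `-γ⁻¹ xy` cancels `x²` in `z²`, leaving a multiple `κ` of
  -- `y²`. With `y, z` as generators, `κ = 0` gives `J12`, and otherwise the sign of `κ` is the
  -- parameter of `J13`.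
  obtain ⟨z, hz⟩ : ∃ z, z = x - (2 * γ)⁻¹ • y := ⟨_, rfl⟩
  have hyz : y * z = γ • (x * x) + (δ - (2 * γ)⁻¹) • (y * y) := by
    rw [hz, mul_sub, mul_smul_comm, mul_comm y x, hxy]
    module
  obtain ⟨κ, hκ⟩ : ∃ κ : ℝ, κ = (2 * γ)⁻¹ ^ 2 - δ / γ := ⟨_, rfl⟩
  have hzz : z * z = κ • (y * y) := by
    have h1 : z * z = x * x - (2 * (2 * γ)⁻¹) • (x * y) + ((2 * γ)⁻¹ ^ 2) • (y * y) := by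
      rw [hz]
      simp only [mul_sub, sub_mul, mul_smul_comm, smul_mul_assoc, mul_comm y x]
      module
    rw [h1, hxy, hκ]
    match_scalars
    · field_simp
      ring
    · field_simp
      ring
  by_cases hκ0 : κ = 0
  · left
    rw [hκ0, zero_smul] at hzz
    refine isIsomorphic_of_products (a := y) (b := z) (c := y * y) (d := y * z) hA _ ?_ (h3' _ _)
      (by intro i; fin_cases i <;> rfl) ?_ ?_ ?_ ?_ ?_ ?_
    · rw [linearIndependent_four_iff]
      intro p q r s h
      obtain ⟨rfl, h1, h2, h4⟩ := hb q (p - q * (2 * γ)⁻¹) (s * γ) (r + s * (δ - (2 * γ)⁻¹))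
        (by rw [← h, hyz, hz]; module)
      simp [hγ] at h2
      subst h2
      refine ⟨?_, rfl, ?_, rfl⟩ <;> linarith
    all_goals simp [Fin.sum_univ_four, table, ec, ed, h3, hzz]
  · right
    obtain ⟨α, t, ht, hα⟩ := exists_sgn_mul_sq hκ0
    refine ⟨α, isIsomorphic_of_products (a := t • y) (b := z) (c := t ^ 2 • (y * y))
      (d := t • (y * z)) hA _ ?_ (fun u => by rw [smul_mul_assoc, h3', smul_zero])
      (by intro i; fin_cases i <;> rfl) ?_ ?_ ?_ ?_ ?_ ?_⟩
    · rw [linearIndependent_four_iff]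
      intro p q r s h
      obtain ⟨rfl, h1, h2, h4⟩ := hb q (p * t - q * (2 * γ)⁻¹) (s * t * γ)
        (r * t ^ 2 + s * t * (δ - (2 * γ)⁻¹)) (by rw [← h, hyz, hz]; module)
      simp [hγ, ht] at h2
      subst h2
      simp [ht] at h1 h4
      exact ⟨h1, rfl, h4, rfl⟩
    all_goals simp [Fin.sum_univ_four, table, ec, ed, h3, hzz, smul_smul, hα, smul_mul_assoc,
      mul_smul_comm]
    all_goals module

/-- `x, y, x², y²` with `xy = 0`. -/
theorem isIsomorphic_J13_one (hA : Module.finrank ℝ A = 4)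
    (h3 : ∀ x y z : A, x * (y * z) = 0) {x y : A}
    (hb : LinearIndependent ℝ ![x, y, x * x, y * y]) (hxy : x * y = 0) :
    IsIsomorphic A (Model (.J13 1)) := by
  rw [linearIndependent_four_iff] at hb
  have hyx : y * x = 0 := by rw [mul_comm, hxy]
  -- The vectors `x, y` play the orthogonal idempotents of `ℝ × ℝ`; their sum and difference satisfy
  -- `a² = b²`.
  refine isIsomorphic_of_products (a := x + y) (b := x - y) (c := x * x + y * y)
    (d := x * x - y * y) hA _ ?_ ?_ (by intro i; fin_cases i <;> rfl) ?_ ?_ ?_ ?_ ?_ ?_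
  · rw [linearIndependent_four_iff]
    intro p q r s h
    obtain ⟨h1, h2, h4, h5⟩ := hb (p + q) (p - q) (r + s) (r - s) (by rw [← h]; module)
    refine ⟨?_, ?_, ?_, ?_⟩ <;> linarith
  · intro u
    rw [mul_comm, mul_sub, h3, h3, sub_zero]
  all_goals
    simp [Fin.sum_univ_four, table, ec, ed, h3, mul_add, add_mul, mul_sub, sub_mul, hxy, hyx, sgn]

end Classification

/-! ### Vanishing triple products, and the final case distinction -/

section Rank

variable {A : Type*} [NonUnitalCommRing A] [Module ℝ A] [IsScalarTower ℝ A A]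
  [SMulCommClass ℝ A A]

theorem sgn_mem (α : ℤˣ) :
    Label.J3 α ∈ associativeLabels ∧ Label.J5 α ∈ associativeLabels ∧
      Label.J13 α ∈ associativeLabels := by
  rcases Int.units_eq_one_or α with rfl | rfl <;> decide

/-- A nondegenerate ternary form is definite or indefinite up to an overall sign, and that sign is
absorbed by replacing `s` with `-s`; this is needed only for signs `(1, -1, -1)`. -/
theorem exists_isIsomorphic_J5 (hA : Module.finrank ℝ A = 4) {x s u v : A} {α β : ℤˣ}
    (hb : LinearIndependent ℝ ![x, s, u, v]) (hs : ∀ y, s * y = 0) (hxx : x * x = s)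
    (hxu : x * u = 0) (hxv : x * v = 0) (huv : u * v = 0) (huu : u * u = sgn α • s)
    (hvv : v * v = sgn β • s) : ∃ γ, IsIsomorphic A (Model (.J5 γ)) := by
  rw [linearIndependent_four_iff] at hb
  have hux : u * x = 0 := by rw [mul_comm, hxu]
  have hvx : v * x = 0 := by rw [mul_comm, hxv]
  have hvu : v * u = 0 := by rw [mul_comm, huv]
  rcases Int.units_eq_one_or α with rfl | rfl
  · refine ⟨β, isIsomorphic_of_products (a := x) (b := u) (c := v) (d := s) hA _ ?_ hs
      (by intro i; fin_cases i <;> rfl) ?_ ?_ ?_ ?_ ?_ ?_⟩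
    · rw [linearIndependent_four_iff]
      intro p q r t h
      have := hb p t q r (by rw [← h]; module)
      tauto
    all_goals simp [Fin.sum_univ_four, table, ed, hxx, hxu, hxv, huv, huu, hvv]
  · rcases Int.units_eq_one_or β with rfl | rfl
    · refine ⟨-1, isIsomorphic_of_products (a := x) (b := v) (c := u) (d := s) hA _ ?_ hs
        (by intro i; fin_cases i <;> rfl) ?_ ?_ ?_ ?_ ?_ ?_⟩
      · rw [linearIndependent_four_iff]
        intro p q r t h
        have := hb p t r q (by rw [← h]; module)
        tauto
      all_goals simp [Fin.sum_univ_four, table, ed, hxx, hxu, hxv, hvu, huu, hvv]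
    · refine ⟨-1, isIsomorphic_of_products (a := u) (b := v) (c := x) (d := -s) hA _ ?_
        (fun y => by rw [neg_mul, hs, neg_zero]) (by intro i; fin_cases i <;> rfl) ?_ ?_ ?_ ?_ ?_ ?_⟩
      · rw [linearIndependent_four_iff]
        intro p q r t h
        obtain ⟨h1, h2, h3, h4⟩ := hb r (-t) p q (by rw [← h]; module)
        exact ⟨h3, h4, h1, neg_eq_zero.1 h2⟩
      all_goals simp [Fin.sum_univ_four, table, ed, hxx, hux, hvx, huv, huu, hvv]

/-- An algebra with a basis `x, x², u, v` whose product takes values in the annihilating line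
spanned by `x²` and is diagonal. -/
theorem exists_isIsomorphic_of_diagonal (hA : Module.finrank ℝ A = 4) {x s u v : A} {p r : ℝ}
    (hb : LinearIndependent ℝ ![x, s, u, v]) (hs : ∀ y, s * y = 0) (hxx : x * x = s)
    (hxu : x * u = 0) (hxv : x * v = 0) (huv : u * v = 0) (huu : u * u = p • s)
    (hvv : v * v = r • s) : ∃ l ∈ associativeLabels, IsIsomorphic A (Model l) := by
  have hb' := linearIndependent_four_iff.1 hb
  have hux : u * x = 0 := by rw [mul_comm, hxu]
  have hvx : v * x = 0 := by rw [mul_comm, hxv]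
  have hvu : v * u = 0 := by rw [mul_comm, huv]
  have hys : ∀ y, y * s = 0 := fun y => by rw [mul_comm, hs]
  -- one radical vector
  have key : ∀ {u v : A} {r : ℝ}, LinearIndependent ℝ ![x, s, u, v] → x * u = 0 → x * v = 0 →
      u * v = 0 → u * u = 0 → v * v = r • s → r ≠ 0 →
      ∃ l ∈ associativeLabels, IsIsomorphic A (Model l) := by
    intro u v r hb hxu hxv huv huu hvv hr
    have hb' := linearIndependent_four_iff.1 hb
    obtain ⟨α, t, ht, hα⟩ := exists_sgn_mul_sq hr
    refine ⟨.J3 α, (sgn_mem α).1, isIsomorphic_of_products (a := x) (b := t⁻¹ • v) (c := s)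
      (d := u) hA _ ?_ (mul_eq_zero_of_basis hA hb (by rw [mul_comm, hxu]) (hys u) huu huv)
      (by intro i; fin_cases i <;> rfl) ?_ ?_ ?_ ?_ ?_ ?_⟩
    · rw [linearIndependent_four_iff]
      intro p q r t' h
      have := hb' p r t' (q * t⁻¹) (by rw [← h]; module)
      simp [ht] at this
      tauto
    · simp [Fin.sum_univ_four, table, ec, hxx]
    · simp [Fin.sum_univ_four, table, hxv, mul_smul_comm]
    · simp [Fin.sum_univ_four, table, hys]
    · simp [Fin.sum_univ_four, table, ec, hvv, smul_mul_assoc, mul_smul_comm, smul_smul, hα]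
      congr 1
      field_simp
    · simp [Fin.sum_univ_four, table, hys]
    · simp [Fin.sum_univ_four, table, hys]
  by_cases hp : p = 0
  · rw [hp, zero_smul] at huu
    by_cases hr : r = 0
    · rw [hr, zero_smul] at hvv
      refine ⟨.J2, by decide, isIsomorphic_of_products hA _ hb
        (mul_eq_zero_of_basis hA hb hvx (hys v) hvu hvv)
        (by intro i; fin_cases i <;> rfl) ?_ ?_ ?_ ?_ ?_ ?_⟩
      all_goals simp [Fin.sum_univ_four, table, eb, hxx, hxu, hs, hys, huu]
    · exact key hb hxu hxv huv huu hvv hr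
  · by_cases hr : r = 0
    · rw [hr, zero_smul] at hvv
      refine key ?_ hxv hxu hvu hvv huu hp
      rw [linearIndependent_four_iff]
      intro p q r t h
      have := hb' p q t r (by rw [← h]; module)
      tauto
    · obtain ⟨α, t, ht, hα⟩ := exists_sgn_mul_sq hp
      obtain ⟨β, w, hw, hβ⟩ := exists_sgn_mul_sq hr
      obtain ⟨γ, hγ⟩ := exists_isIsomorphic_J5 hA (x := x) (s := s) (u := t⁻¹ • u) (v := w⁻¹ • v)
        (α := α) (β := β) (by
          rw [linearIndependent_four_iff]
          intro p q r t' h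
          have := hb' p q (r * t⁻¹) (t' * w⁻¹) (by rw [← h]; module)
          simpa [ht, hw] using this) hs hxx
        (by rw [mul_smul_comm, hxu, smul_zero]) (by rw [mul_smul_comm, hxv, smul_zero])
        (by rw [mul_smul_comm, smul_mul_assoc, huv, smul_zero, smul_zero])
        (by
          rw [mul_smul_comm, smul_mul_assoc, huu, hα, smul_smul, smul_smul]
          congr 1
          field_simp)
        (by
          rw [mul_smul_comm, smul_mul_assoc, hvv, hβ, smul_smul, smul_smul]
          congr 1
          field_simp)
      exact ⟨_, (sgn_mem γ).2.1, hγ⟩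

/-- Diagonalization of the form on `u, v`: complete the square if one of them has nonzero square,
and otherwise pass to `u ± v`, with squares `±2q s`. -/
theorem exists_isIsomorphic_of_orthogonal (hA : Module.finrank ℝ A = 4) {x s u v : A} {p q r : ℝ}
    (hb : LinearIndependent ℝ ![x, s, u, v]) (hs : ∀ y, s * y = 0) (hxx : x * x = s)
    (hxu : x * u = 0) (hxv : x * v = 0) (huv : u * v = q • s) (huu : u * u = p • s)
    (hvv : v * v = r • s) : ∃ l ∈ associativeLabels, IsIsomorphic A (Model l) := by
  have key : ∀ {u v : A} {p r : ℝ}, LinearIndependent ℝ ![x, s, u, v] → x * u = 0 → x * v = 0 →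
      u * v = q • s → u * u = p • s → v * v = r • s → p ≠ 0 →
      ∃ l ∈ associativeLabels, IsIsomorphic A (Model l) := by
    intro u v p r hb hxu hxv huv huu hvv hp
    have huv' : u * (v - (q / p) • u) = 0 := by
      rw [mul_sub, mul_smul_comm, huv, huu]
      match_scalars
      field_simp
      ring
    refine exists_isIsomorphic_of_diagonal hA (v := v - (q / p) • u) (r := r - q / p * q) ?_ hs hxx
      hxu ?_ huv' huu ?_
    · rw [linearIndependent_four_iff] at hb ⊢
      intro a b c d h
      obtain ⟨h1, h2, h3, rfl⟩ := hb a b (c - d * (q / p)) d (by rw [← h]; module)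
      exact ⟨h1, h2, by linarith, rfl⟩
    · rw [mul_sub, mul_smul_comm, hxu, hxv, smul_zero, sub_zero]
    · rw [sub_mul, smul_mul_assoc, huv', smul_zero, sub_zero, mul_sub, mul_smul_comm, mul_comm v u,
        hvv, huv]
      module
  by_cases hp : p = 0
  · by_cases hr : r = 0
    · rw [hp, zero_smul] at huu
      rw [hr, zero_smul] at hvv
      refine exists_isIsomorphic_of_diagonal hA (u := u + v) (v := u - v) (p := 2 * q)
        (r := -(2 * q)) ?_ hs hxx ?_ ?_ ?_ ?_ ?_
      · rw [linearIndependent_four_iff] at hb ⊢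
        intro a b c d h
        obtain ⟨h1, h2, h3, h4⟩ := hb a b (c + d) (c - d) (by rw [← h]; module)
        refine ⟨h1, h2, ?_, ?_⟩ <;> linarith
      · rw [mul_add, hxu, hxv, add_zero]
      · rw [mul_sub, hxu, hxv, sub_zero]
      all_goals
        simp only [mul_add, mul_sub, add_mul, sub_mul, huu, hvv, mul_comm v u, huv]
        module
    · refine key ?_ hxv hxu (by rw [mul_comm, huv]) hvv huu hr
      rw [linearIndependent_four_iff] at hb ⊢
      intro a b c d h
      have := hb a b d c (by rw [← h]; module)
      tauto
  · exact key hb hxu hxv huv huu hvv hp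

/-- The product is a symmetric bilinear form with values in an annihilating line. -/
theorem exists_isIsomorphic_of_rank_one (hA : Module.finrank ℝ A = 4)
    (h3 : ∀ x y z : A, x * (y * z) = 0) {x : A} (hx : x * x ≠ 0)
    (h : ∀ y z : A, ∃ r : ℝ, y * z = r • (x * x)) :
    ∃ l ∈ associativeLabels, IsIsomorphic A (Model l) := by
  have hli : LinearIndependent ℝ ![x, x * x] := by
    rw [LinearIndependent.pair_iff]
    intro p q hpq
    have h1 := congrArg (fun y => x * y) hpq
    simp only [mul_add, mul_smul_comm, h3, smul_zero, add_zero, mul_zero] at h1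
    obtain rfl := smul_eq_zero_left hx h1
    rw [zero_smul, zero_add] at hpq
    exact ⟨rfl, smul_eq_zero_left hx hpq⟩
  obtain ⟨u, v, hb⟩ := exists_linearIndependent_pair hA hli
  obtain ⟨p, hp⟩ := h x u
  obtain ⟨q, hq⟩ := h x v
  obtain ⟨a, ha⟩ := h (u - p • x) (u - p • x)
  obtain ⟨b, hab⟩ := h (u - p • x) (v - q • x)
  obtain ⟨c, hc⟩ := h (v - q • x) (v - q • x)
  refine exists_isIsomorphic_of_orthogonal hA ?_ (fun y => by rw [mul_comm, h3]) rfl ?_ ?_ hab ha hc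
  · rw [linearIndependent_four_iff] at hb ⊢
    intro a b c d h
    obtain ⟨h1, h2, rfl, rfl⟩ := hb (a - c * p - d * q) b c d (by rw [← h]; module)
    exact ⟨by linarith, h2, rfl, rfl⟩
  · rw [mul_sub, mul_smul_comm, hp, sub_self]
  · rw [mul_sub, mul_smul_comm, hq, sub_self]

theorem exists_isIsomorphic_of_rank_two (hA : Module.finrank ℝ A = 4)
    (h3 : ∀ x y z : A, x * (y * z) = 0) {x y : A} (h : LinearIndependent ℝ ![x * x, y * y]) :
    ∃ l ∈ associativeLabels, IsIsomorphic A (Model l) := by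
  rw [LinearIndependent.pair_iff] at h
  -- Only the zero combination `px + qy` kills both `x` and `y`: eliminating `xy` leaves `p²x² -
  -- q²y² = 0`. This gives both the independence of the four vectors and the absence of `x, y` terms
  -- in `xy`.
  have aux : ∀ p q : ℝ, p • (x * x) + q • (x * y) = 0 → p • (x * y) + q • (y * y) = 0 →
      p = 0 ∧ q = 0 := by
    intro p q h1 h2
    obtain ⟨h4, h5⟩ := h (p ^ 2) (-(q ^ 2)) (by
      linear_combination (norm := module) p • h1 - q • h2)
    simpa using And.intro h4 h5
  have hb : LinearIndependent ℝ ![x, y, x * x, y * y] := by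
    rw [linearIndependent_four_iff]
    intro p q r s hs
    have h1 := congrArg (fun z => x * z) hs
    have h2 := congrArg (fun z => y * z) hs
    simp only [mul_add, mul_smul_comm, h3, smul_zero, add_zero, mul_zero, mul_comm y x] at h1 h2
    obtain ⟨rfl, rfl⟩ := aux p q h1 h2
    have := h r s (by rw [← hs]; module)
    tauto
  obtain ⟨p, q, γ, δ, hxy⟩ := exists_eq_of_linearIndependent hA hb (x * y)
  have h1 : x * (x * y) = 0 := h3 _ _ _
  have h2 : y * (x * y) = 0 := h3 _ _ _
  rw [hxy] at h1 h2
  simp only [mul_add, mul_smul_comm, h3, smul_zero, add_zero, mul_comm y x] at h1 h2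
  obtain ⟨rfl, rfl⟩ := aux p q h1 h2
  rw [zero_smul, zero_smul, zero_add, zero_add] at hxy
  have hJ : (IsIsomorphic A (Model .J12) ∨ ∃ α, IsIsomorphic A (Model (.J13 α))) →
      ∃ l ∈ associativeLabels, IsIsomorphic A (Model l) := by
    rintro (h | ⟨α, h⟩)
    exacts [⟨_, by decide, h⟩, ⟨_, (sgn_mem α).2.2, h⟩]
  by_cases hγ : γ = 0
  · by_cases hδ : δ = 0
    · rw [hγ, hδ, zero_smul, zero_smul, zero_add] at hxy
      exact ⟨_, by decide, isIsomorphic_J13_one hA h3 hb hxy⟩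
    · refine hJ (exists_isIsomorphic_J12_J13 hA h3 (x := y) (y := x) (γ := δ) (δ := γ) ?_ ?_ hδ)
      · rw [linearIndependent_four_iff] at hb ⊢
        intro p q r s hs
        have := hb q p s r (by rw [← hs]; module)
        tauto
      · rw [mul_comm, hxy, add_comm]
  · exact hJ (exists_isIsomorphic_J12_J13 hA h3 hb hxy hγ)

theorem exists_isIsomorphic_model (hA : Module.finrank ℝ A = 4) (hn : IsNilpotentAlgebra A) :
    ∃ l ∈ associativeLabels, IsIsomorphic A (Model l) := by
  have : FiniteDimensional ℝ A := Module.finite_of_finrank_pos (by omega)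
  have h5 : ∀ x y z t u : A, x * y * z * t * u = 0 := by
    intro x y z t u
    have h0 : x ∈ lowerCentral A 0 := Submodule.mem_top
    have h4 := mul_mem_lowerCentral (mul_mem_lowerCentral (mul_mem_lowerCentral
      (mul_mem_lowerCentral h0 y) z) t) u
    -- The series is indexed from `0`, so its term of index 4 contains the products of five factors.
    have hbot := lowerCentral_finrank_eq_bot hn
    rw [hA] at hbot
    rw [zero_add, one_add_one_eq_two, two_add_one_eq_three, three_add_one_eq_four, hbot] at h4
    exact (Submodule.mem_bot ℝ).1 h4
  by_cases h4 : ∀ x : A, x * (x * (x * x)) = 0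
  swap
  · push Not at h4
    obtain ⟨x, hx⟩ := h4
    exact ⟨_, by decide, isIsomorphic_J11 hA h5 hx⟩
  by_cases h3 : ∀ x : A, x * (x * x) = 0
  swap
  · push Not at h3
    obtain ⟨x, hx⟩ := h3
    rcases isIsomorphic_J4_or_J7 hA (mul_cube_eq_zero_of_fourth h4) hx with h | h
    exacts [⟨_, by decide, h⟩, ⟨_, by decide, h⟩]
  replace h3 := mul_mul_eq_zero_of_cube h3
  by_cases h2 : ∀ x : A, x * x = 0
  · have hz := mul_eq_zero_of_sq h2
    refine ⟨.J1, by decide, isIsomorphic_of_table hA _ (Module.finBasisOfFinrankEq ℝ A hA).linearIndependent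
      fun i j => ?_⟩
    simp [hz, table]
  push Not at h2
  obtain ⟨x, hx⟩ := h2
  by_cases h1 : ∀ y : A, ∃ r : ℝ, y * y = r • (x * x)
  -- If all squares lie on the line of `x²`, so do all products, by `2yz = (y + z)² - y² - z²`.
  · refine exists_isIsomorphic_of_rank_one hA h3 hx fun y z => ?_
    obtain ⟨p, hp⟩ := h1 (y + z)
    obtain ⟨q, hq⟩ := h1 y
    obtain ⟨r, hr⟩ := h1 z
    refine ⟨(p - q - r) / 2, ?_⟩
    simp only [mul_add, add_mul, mul_comm z y] at hp
    linear_combination (norm := module) (1 / 2 : ℝ) • (hp - hq - hr)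
  · push Not at h1
    obtain ⟨y, hy⟩ := h1
    refine exists_isIsomorphic_of_rank_two hA h3 (x := x) (y := y) ?_
    rw [LinearIndependent.pair_iff' hx]
    exact fun r => (hy r).symm

end Rank

end RealNilpotentJordan

theorem mainTheorem5 :
    -- the twelve models are commutative nilpotent associative algebras of dimension 4
    RealNilpotentJordan.associativeLabels.card = 12 ∧
    (∀ l ∈ RealNilpotentJordan.associativeLabels,
      Module.finrank ℝ (RealNilpotentJordan.Model l) = 4 ∧
      RealNilpotentJordan.IsNilpotentAlgebra (RealNilpotentJordan.Model l) ∧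
      (∀ x y : RealNilpotentJordan.Model l, x * y = y * x) ∧
      (∀ x y z : RealNilpotentJordan.Model l, x * y * z = x * (y * z))) ∧
    -- they are pairwise non-isomorphic
    (∀ l ∈ RealNilpotentJordan.associativeLabels,
      ∀ l' ∈ RealNilpotentJordan.associativeLabels,
      RealNilpotentJordan.IsIsomorphic (RealNilpotentJordan.Model l)
        (RealNilpotentJordan.Model l') → l = l') ∧
    -- every commutative nilpotent associative algebra of dimension 4 is isomorphic to one of them
    (∀ (A : Type*) [NonUnitalCommRing A] [Module ℝ A] [IsScalarTower ℝ A A]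
      [SMulCommClass ℝ A A],
      Module.finrank ℝ A = 4 → RealNilpotentJordan.IsNilpotentAlgebra A →
      ∃ l ∈ RealNilpotentJordan.associativeLabels,
        RealNilpotentJordan.IsIsomorphic A (RealNilpotentJordan.Model l)) ∧
    -- those listed as having a central component are exactly those that have one
    (∀ l ∈ RealNilpotentJordan.associativeLabels,
      (RealNilpotentJordan.HasCentralComponent (RealNilpotentJordan.Model l) ↔
        l ∈ RealNilpotentJordan.centralComponentLabels)) ∧
    -- they are the associative members of the list of 17 nilpotent Jordan algebras of dimension 4
    Nat.card RealNilpotentJordan.Label = 17 ∧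
    (∀ l : RealNilpotentJordan.Label,
      Module.finrank ℝ (RealNilpotentJordan.Model l) = 4 ∧
      RealNilpotentJordan.IsNilpotentAlgebra (RealNilpotentJordan.Model l) ∧
      IsCommJordan (RealNilpotentJordan.Model l)) ∧
    (∀ l : RealNilpotentJordan.Label,
      l ∈ RealNilpotentJordan.associativeLabels ↔
        ∀ x y z : RealNilpotentJordan.Model l, x * y * z = x * (y * z)) := by
  refine ⟨by decide, fun l hl => ⟨RealNilpotentJordan.finrank_model l,
    RealNilpotentJordan.isNilpotentAlgebra_model l, mul_comm,
    RealNilpotentJordan.mul_assoc_of_mem hl⟩,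
    fun l hl l' hl' => RealNilpotentJordan.eq_of_isIsomorphic_model hl hl', ?_,
    fun l => RealNilpotentJordan.hasCentralComponent_iff, RealNilpotentJordan.card_label,
    fun l => ⟨RealNilpotentJordan.finrank_model l,
      RealNilpotentJordan.isNilpotentAlgebra_model l, RealNilpotentJordan.isCommJordan_model l⟩,
    fun l => ⟨RealNilpotentJordan.mul_assoc_of_mem, RealNilpotentJordan.mem_of_mul_assoc l⟩⟩
  intro A _ _ _ _ hA hn
  exact RealNilpotentJordan.exists_isIsomorphic_model hA hn
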